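/- Let $N\ge 1$ be an integer and let $\beta\ge 0$. For $\mathbf a=(a_1,\dots,a_N)$ with all $a_j>0$ let $\Omega(\mathbf a)=(-a_1,a_1)\times\cdots\times(-a_N,a_N)\subset\mathbb R^N$. A real number $\lambda$ is a Robin eigenvalue of $\Omega(\mathbf a)$ if there is a function $u\in C^2(\Omega(\mathbf a))\cap C^1(\overline{\Omega(\mathbf a)})$, not identically zero, with $$\Delta u+\lambda u=0\ \text{ in }\Omega(\mathbf a),\qquad \beta\,\frac{\partial u}{\partial n}+u=0\ \text{ on }\partial\Omega(\mathbf a),$$ where $n$ is the outward unit normal (the boundary condition is required on each face). The fundamental eigenvalue $\lambda_1(\mathbf a)=\lambda_1(\Omega(\mathbf a))$ is the least Robin eigenvalue. For $c>0$ let $\mu(c)$ be the smallest positive solution of $\mu\tan(c\mu)=1/\beta$ if $\beta>0$, and $\mu(c)=\pi/(2c)$ if $\beta=0$. Then, if $\beta>0$, $\mu(c)$ exists and $0<\mu(c)<\pi/(2c)$ for every $c>0$; for every $\beta\ge 0$ the least Robin eigenvalue $\lambda_1(\mathbf a)$ exists for every $\mathbf a$ with positive entries, and $$\lambda_1(\mathbf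 a)=\sum_{j=1}^N\mu(a_j)^2 .$$ Moreover $\lambda_1$ is a convex function of $(\ell_1,\dots,\ell_N)\in\mathbb R^N$, where $\ell_j=\log a_j$. Equivalently, for all $\mathbf a(0),\mathbf a(1)$ with positive entries, and with $\mathbf a(t)=\bigl(a_j(0)^{1-t}a_j(1)^t\bigr)_{j=1}^N$, $$\lambda_1(\mathbf a(t))\le(1-t)\,\lambda_1(\mathbf a(0))+t\,\lambda_1(\mathbf a(1))\qquad\text{for } 0<t<1 .$$ -/

import Mathlib

/-- The open box `(-a_1, a_1) × ⋯ × (-a_N, a_N)` in Euclidean space. -/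
def openBox {N : ℕ} (a : Fin N → ℝ) : Set (EuclideanSpace ℝ (Fin N)) :=
  {x | ∀ j, |x j| < a j}

/-- The closed box `[-a_1, a_1] × ⋯ × [-a_N, a_N]`, the closure of `openBox a` when all `a j > 0`. -/
def closedBox {N : ℕ} (a : Fin N → ℝ) : Set (EuclideanSpace ℝ (Fin N)) :=
  {x | ∀ j, |x j| ≤ a j}

/-- `u` is a classical solution, not identically zero, of the Robin problem
`Δ u + lam u = 0` in the open box, `β ∂u/∂n + u = 0` on its boundary, with `u` of class `C²` in
the open box and `C¹` up to the boundary. The outward unit normal on the face `x_j = σ a_j`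
(`σ = ±1`) is `σ e_j`. Since `u` is `C¹` up to the boundary, imposing the boundary condition on the
closed faces is the same as imposing it on the relatively open ones. -/
structure IsRobinEigenfunction {N : ℕ} (β : ℝ) (a : Fin N → ℝ) (lam : ℝ)
    (u : EuclideanSpace ℝ (Fin N) → ℝ) : Prop where
  contDiffOn_open : ContDiffOn ℝ 2 u (openBox a)
  contDiffOn_closed : ContDiffOn ℝ 1 u (closedBox a)
  helmholtz : ∀ x ∈ openBox a, Laplacian.laplacian u x + lam * u x = 0
  robin : ∀ x ∈ closedBox a, ∀ (j : Fin N) (σ : ℝ), (σ = 1 ∨ σ = -1) → x j = σ * a j →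
    β * fderivWithin ℝ u (closedBox a) x (EuclideanSpace.single j σ) + u x = 0
  nontrivial : ∃ x ∈ openBox a, u x ≠ 0

/-- The set of Robin eigenvalues of the box with half-sides `a`. -/
def robinEigenvalues {N : ℕ} (β : ℝ) (a : Fin N → ℝ) : Set ℝ :=
  {lam | ∃ u, IsRobinEigenfunction β a lam u}

/-- The fundamental Robin eigenvalue `λ₁` of the box with half-sides `a`: the least eigenvalue. -/
noncomputable def fundamentalRobinEigenvalue {N : ℕ} (β : ℝ) (a : Fin N → ℝ) : ℝ :=
  sInf (robinEigenvalues β a)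

/-- The positive solutions `m` of the transcendental equation `m tan (c m) = 1 / β`. -/
def muEquationSolutions (β c : ℝ) : Set ℝ :=
  {m | 0 < m ∧ m * Real.tan (c * m) = 1 / β}

/-- `μ(β, c)`: the smallest positive solution of `m tan (c m) = 1 / β` when `β > 0`, and
`μ(0, c) = π / (2 c)`. -/
noncomputable def robinMu (β c : ℝ) : ℝ :=
  if β = 0 then Real.pi / (2 * c) else sInf (muEquationSolutions β c)

/-!
Write `m_j = μ(β, a_j)` and `Λ = ∑ m_j²`. The product `∏ cos (m_j x_j)` solves the Robin problem
with eigenvalue `Λ` (`isRobinEigenfunction_cosProd`), because `m_j` satisfies the pole-free equation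
`cos (m_j a_j) = β m_j sin (m_j a_j)`, which makes sense for `β = 0` as well.

There is no smaller eigenvalue. If `lam < Λ`, choose `s < 1` with `lam < s² Λ`. The function
`φ = ∏ cos (s m_j x_j)` is then positive on the closed box and is a strict supersolution, both of
the equation and of the boundary condition. For an eigenfunction `u`, compare `u` with `M φ`, where
`M = max u / φ`. If `M` were positive, then `u - M φ` would have a maximum at which either its
Laplacian is positive (interior) or its outward derivative is negative (boundary), which is
impossible (`IsRobinEigenfunction.nonpos_of_supersolution`). Strictness on the boundary replaces
Hopf's lemma, and no integration by parts is needed. Hence `u ≤ 0`, likewise `-u ≤ 0`, and `u = 0`.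

For convexity it suffices to treat `ℓ ↦ μ(β, exp ℓ)²`. For `β = 0` this is a multiple of
`exp (-2 ℓ)`. For `β > 0` put `θ = c μ(β, c)` with `c = exp ℓ`; then `θ ∈ (0, π / 2)` and
`ℓ = log β + log θ + log (tan θ)`, `μ² = cot² θ / β²`, so the graph is, up to affine changes of
coordinates, the curve `θ ↦ (log θ + log (tan θ), cot² θ)`. Its slope is
`-2 / (tan² θ + (tan θ / θ) sin² θ)`, which increases with `θ` because `tan θ`, `tan θ / θ` and
`sin θ` do. Therefore the graph lies above each of its tangents (`cot_sq_supporting_line`).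
-/

/-! ### The Laplacian along coordinate lines -/

theorem deriv_deriv_comp_line {E : Type*} [NormedAddCommGroup E] [NormedSpace ℝ E]
    {f : E → ℝ} {x : E} (hf : ContDiffAt ℝ 2 f x) (e : E) :
    deriv (deriv fun t : ℝ => f (x + t • e)) 0 = iteratedFDeriv ℝ 2 f x ![e, e] := by
  have hline : ∀ t : ℝ, HasDerivAt (fun t : ℝ => x + t • e) e t := fun t => by
    simpa using ((hasDerivAt_id t).smul_const e).const_add x
  have hcont : Filter.Tendsto (fun t : ℝ => x + t • e) (nhds 0) (nhds x) := by
    simpa using (hline 0).continuousAt.tendsto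
  have hdiff : ∀ᶠ y in nhds x, DifferentiableAt ℝ f y :=
    (hf.eventually (by simp)).mono fun y hy => hy.differentiableAt two_ne_zero
  have h1 : deriv (fun t : ℝ => f (x + t • e)) =ᶠ[nhds 0] fun t => fderiv ℝ f (x + t • e) e :=
    (hcont.eventually hdiff).mono fun t ht => (ht.hasFDerivAt.comp_hasDerivAt t (hline t)).deriv
  rw [h1.deriv_eq, iteratedFDeriv_two_apply]
  have h2 : DifferentiableAt ℝ (fderiv ℝ f) x :=
    (hf.fderiv_right (m := 1) (by norm_num)).differentiableAt one_ne_zero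
  have h3 : HasFDerivAt (fun y => fderiv ℝ f y e)
      ((ContinuousLinearMap.apply ℝ ℝ e).comp (fderiv ℝ (fderiv ℝ f) x)) (x + (0 : ℝ) • e) := by
    rw [zero_smul, add_zero]
    exact (ContinuousLinearMap.apply ℝ ℝ e).hasFDerivAt.comp x h2.hasFDerivAt
  exact (h3.comp_hasDerivAt (0 : ℝ) (hline 0)).deriv

theorem laplacian_eq_sum_deriv_deriv {N : ℕ} {f : EuclideanSpace ℝ (Fin N) → ℝ}
    {x : EuclideanSpace ℝ (Fin N)} (hf : ContDiffAt ℝ 2 f x) :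
    Laplacian.laplacian f x =
      ∑ j, deriv (deriv fun t : ℝ => f (x + t • EuclideanSpace.single j 1)) 0 := by
  rw [InnerProductSpace.laplacian_eq_iteratedFDeriv_orthonormalBasis f
    (EuclideanSpace.basisFun (Fin N) ℝ)]
  simp [deriv_deriv_comp_line hf]

theorem IsLocalMax.deriv_deriv_nonpos {g : ℝ → ℝ} {t : ℝ} (h : IsLocalMax g t)
    (hg : ContinuousAt g t) : deriv (deriv g) t ≤ 0 := by
  by_contra! hpos
  have hmin := isLocalMin_of_deriv_deriv_pos hpos h.deriv_eq_zero hg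
  -- a point that is both a local maximum and a local minimum has a neighbourhood of constancy
  have hconst : g =ᶠ[nhds t] fun _ => g t := by
    filter_upwards [h, hmin] with s h1 h2 using le_antisymm h1 h2
  have hd : deriv g =ᶠ[nhds t] fun _ => 0 := by
    simpa using hconst.deriv
  rw [hd.deriv_eq] at hpos
  simp at hpos

theorem IsLocalMax.laplacian_nonpos {N : ℕ} {f : EuclideanSpace ℝ (Fin N) → ℝ}
    {x : EuclideanSpace ℝ (Fin N)} (h : IsLocalMax f x) (hf : ContDiffAt ℝ 2 f x) :
    Laplacian.laplacian f x ≤ 0 := by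
  rw [laplacian_eq_sum_deriv_deriv hf]
  refine Finset.sum_nonpos fun j _ => IsLocalMax.deriv_deriv_nonpos ?_ ?_
  · have hc : ContinuousAt (fun t : ℝ => x + t • EuclideanSpace.single j (1 : ℝ)) 0 := by fun_prop
    have hc' : Filter.Tendsto (fun t : ℝ => x + t • EuclideanSpace.single j (1 : ℝ))
        (nhds 0) (nhds x) := by simpa using hc.tendsto
    have := hc'.eventually h
    simpa [IsLocalMax, IsMaxFilter] using this
  · have : ContinuousAt f (x + (0 : ℝ) • EuclideanSpace.single j (1 : ℝ)) := by
      simpa using hf.continuousAt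
    exact ContinuousAt.comp (f := fun t : ℝ => x + t • EuclideanSpace.single j (1 : ℝ)) this
      (by fun_prop)

/-! ### Products of cosines -/

/-- The product `∏ cos (m_j x_j)`; with `m_j = μ(β, a_j)` it is the ground state of the box. -/
noncomputable def cosProd {N : ℕ} (m : Fin N → ℝ) (x : EuclideanSpace ℝ (Fin N)) : ℝ :=
  ∏ j, Real.cos (m j * x j)

theorem contDiff_cosProd {N : ℕ} (m : Fin N → ℝ) {n : WithTop ℕ∞} :
    ContDiff ℝ n (cosProd m) := by
  unfold cosProd
  fun_prop

theorem cosProd_add_smul_single {N : ℕ} (m : Fin N → ℝ) (x : EuclideanSpace ℝ (Fin N))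
    (j : Fin N) (t : ℝ) :
    cosProd m (x + t • EuclideanSpace.single j 1) =
      (∏ i ∈ Finset.univ.erase j, Real.cos (m i * x i)) * Real.cos (m j * (x j + t)) := by
  rw [cosProd, ← Finset.prod_erase_mul _ _ (Finset.mem_univ j)]
  congr 1
  · refine Finset.prod_congr rfl fun i hi => ?_
    simp [Finset.ne_of_mem_erase hi]
  · simp

theorem hasDerivAt_cosProd_line {N : ℕ} (m : Fin N → ℝ) (x : EuclideanSpace ℝ (Fin N))
    (j : Fin N) (t : ℝ) :
    HasDerivAt (fun t : ℝ => cosProd m (x + t • EuclideanSpace.single j 1))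
      ((∏ i ∈ Finset.univ.erase j, Real.cos (m i * x i)) *
        (-(m j * Real.sin (m j * (x j + t))))) t := by
  simp only [cosProd_add_smul_single]
  have h : HasDerivAt (fun t : ℝ => m j * (x j + t)) (m j) t := by
    simpa using ((hasDerivAt_id t).const_add (x j)).const_mul (m j)
  refine (h.cos.const_mul (∏ i ∈ Finset.univ.erase j, Real.cos (m i * x i))).congr_deriv ?_
  ring

theorem laplacian_cosProd {N : ℕ} (m : Fin N → ℝ) (x : EuclideanSpace ℝ (Fin N)) :
    Laplacian.laplacian (cosProd m) x = -(∑ j, m j ^ 2) * cosProd m x := by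
  rw [laplacian_eq_sum_deriv_deriv (contDiff_cosProd m).contDiffAt, neg_mul, Finset.sum_mul,
    ← Finset.sum_neg_distrib]
  refine Finset.sum_congr rfl fun j _ => ?_
  rw [funext fun t => (hasDerivAt_cosProd_line m x j t).deriv]
  have h : HasDerivAt (fun t : ℝ => m j * (x j + t)) (m j) 0 := by
    simpa using ((hasDerivAt_id (0 : ℝ)).const_add (x j)).const_mul (m j)
  have h2 : HasDerivAt (fun t : ℝ => (∏ i ∈ Finset.univ.erase j, Real.cos (m i * x i)) *
      -(m j * Real.sin (m j * (x j + t)))) _ 0 :=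
    (h.sin.const_mul (m j)).neg.const_mul (∏ i ∈ Finset.univ.erase j, Real.cos (m i * x i))
  rw [h2.deriv, cosProd, ← Finset.prod_erase_mul _ _ (Finset.mem_univ j)]
  simp only [add_zero]
  ring

theorem fderiv_cosProd_single {N : ℕ} (m : Fin N → ℝ) (x : EuclideanSpace ℝ (Fin N))
    (j : Fin N) (σ : ℝ) :
    fderiv ℝ (cosProd m) x (EuclideanSpace.single j σ) =
      -(σ * m j * Real.sin (m j * x j)) * ∏ i ∈ Finset.univ.erase j, Real.cos (m i * x i) := by
  have hline : HasDerivAt (fun t : ℝ => x + t • EuclideanSpace.single j (1 : ℝ))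
      (EuclideanSpace.single j 1) 0 := by
    simpa using ((hasDerivAt_id (0 : ℝ)).smul_const (EuclideanSpace.single j (1 : ℝ))).const_add x
  have hd : DifferentiableAt ℝ (cosProd m) (x + (0 : ℝ) • EuclideanSpace.single j (1 : ℝ)) :=
    ((contDiff_cosProd m).differentiable one_ne_zero).differentiableAt
  have h0 : HasDerivAt (fun t : ℝ => cosProd m (x + t • EuclideanSpace.single j 1)) _ 0 :=
    HasFDerivAt.comp_hasDerivAt (l := cosProd m) (0 : ℝ) hd.hasFDerivAt hline
  have h := h0.unique (hasDerivAt_cosProd_line m x j 0)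
  have hs : EuclideanSpace.single j σ = σ • EuclideanSpace.single j (1 : ℝ) := by
    ext i; by_cases hi : i = j <;> simp [hi]
  simp only [zero_smul, add_zero] at h
  rw [hs, map_smul, h, smul_eq_mul]
  ring

/-- The Robin boundary operator applied to a product of cosines on the face `x_j = σ a_j`
factors; the one-dimensional factor decides its sign. -/
theorem robin_cosProd {N : ℕ} (β : ℝ) (a m : Fin N → ℝ) (x : EuclideanSpace ℝ (Fin N))
    (j : Fin N) (σ : ℝ) (hσ : σ = 1 ∨ σ = -1) (hx : x j = σ * a j) :
    β * fderiv ℝ (cosProd m) x (EuclideanSpace.single j σ) + cosProd m x =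
      (Real.cos (m j * a j) - β * (m j * Real.sin (m j * a j))) *
        ∏ i ∈ Finset.univ.erase j, Real.cos (m i * x i) := by
  rw [fderiv_cosProd_single, cosProd, ← Finset.prod_erase_mul _ _ (Finset.mem_univ j), hx]
  rcases hσ with rfl | rfl
  · simp only [one_mul]; ring
  · simp only [neg_mul, one_mul, mul_neg, Real.sin_neg, Real.cos_neg]; ring

/-! ### Geometry of the box -/

theorem openBox_subset_closedBox {N : ℕ} (a : Fin N → ℝ) : openBox a ⊆ closedBox a :=
  fun _ hx j => (hx j).le

theorem isOpen_openBox {N : ℕ} (a : Fin N → ℝ) : IsOpen (openBox a) := by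
  simp only [openBox, Set.ofPred_forall]
  exact isOpen_iInter_of_finite fun j => isOpen_lt (by fun_prop) continuous_const

theorem convex_closedBox {N : ℕ} (a : Fin N → ℝ) : Convex ℝ (closedBox a) := by
  intro x hx y hy s t hs ht hst j
  have := (abs_add_le (s * x j) (t * y j))
  rw [abs_mul, abs_mul, abs_of_nonneg hs, abs_of_nonneg ht] at this
  have h1 := mul_le_mul_of_nonneg_left (hx j) hs
  have h2 := mul_le_mul_of_nonneg_left (hy j) ht
  have h3 : s * a j + t * a j = a j := by rw [← add_mul, hst, one_mul]
  simpa using this.trans (by linarith)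

theorem isCompact_closedBox {N : ℕ} (a : Fin N → ℝ) : IsCompact (closedBox a) := by
  have h : closedBox a = (EuclideanSpace.equiv (Fin N) ℝ).toHomeomorph ⁻¹'
      (Set.univ.pi fun j => Set.Icc (-a j) (a j)) := by
    ext x
    simp only [closedBox, abs_le, Set.mem_ofPred_eq, Set.mem_preimage, Set.mem_univ_pi, Set.mem_Icc]
    rfl
  rw [h, Homeomorph.isCompact_preimage]
  exact isCompact_univ_pi fun j => isCompact_Icc

theorem uniqueDiffOn_closedBox {N : ℕ} {a : Fin N → ℝ} (ha : ∀ j, 0 < a j) :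
    UniqueDiffOn ℝ (closedBox a) :=
  uniqueDiffOn_convex (convex_closedBox a)
    ⟨0, interior_maximal (openBox_subset_closedBox a) (isOpen_openBox a) fun j => by simpa using ha j⟩

theorem neg_single_mem_posTangentConeAt_closedBox {N : ℕ} {a : Fin N → ℝ} (ha : ∀ j, 0 < a j)
    {x : EuclideanSpace ℝ (Fin N)} (hx : x ∈ closedBox a) {j : Fin N} {σ : ℝ}
    (hxj : x j = σ * a j) :
    -((a j) • EuclideanSpace.single j σ) ∈ posTangentConeAt (closedBox a) x := by
  refine mem_posTangentConeAt_of_segment_subset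
    ((convex_closedBox a).segment_subset hx fun i => ?_)
  by_cases hi : i = j
  · subst hi
    simpa [hxj, mul_comm] using (ha i).le
  · simpa [hi] using hx i

/-! ### The frequency `μ(β, c)` -/

theorem exists_isLeast_muEquationSolutions {β c : ℝ} (hβ : 0 < β) (hc : 0 < c) :
    ∃ m, IsLeast (muEquationSolutions β c) m ∧ c * m < Real.pi / 2 := by
  have hpi := Real.pi_pos
  have hb : 0 ≤ Real.pi / (2 * c) := by positivity
  have hcb : c * (Real.pi / (2 * c)) = Real.pi / 2 := by field_simp
  -- the pole-free form `β m sin (c m) = cos (c m)` of the equation is amenable to the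
  -- intermediate value theorem
  obtain ⟨m, ⟨hm0, hm1⟩, hm⟩ := intermediate_value_Ioo hb
    (f := fun m => β * m * Real.sin (c * m) - Real.cos (c * m)) (by fun_prop)
    (show (0 : ℝ) ∈ Set.Ioo _ _ by
      simp only [hcb, mul_zero, Real.sin_zero, Real.cos_zero, Real.sin_pi_div_two,
        Real.cos_pi_div_two]
      constructor
      · norm_num
      · have : 0 < β * (Real.pi / (2 * c)) := by positivity
        linarith)
  have hcm : c * m < Real.pi / 2 := hcb ▸ mul_lt_mul_of_pos_left hm1 hc
  have hcm0 : 0 < c * m := mul_pos hc hm0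
  have hcos : 0 < Real.cos (c * m) := Real.cos_pos_of_mem_Ioo ⟨by linarith, hcm⟩
  have heq : m * Real.tan (c * m) = 1 / β := by
    simp only at hm
    rw [Real.tan_eq_sin_div_cos, ← mul_div_assoc, div_eq_div_iff hcos.ne' hβ.ne']
    linarith
  refine ⟨m, ⟨⟨hm0, heq⟩, ?_⟩, hcm⟩
  rintro m' ⟨hm'0, hm'⟩
  by_contra! hlt
  have htan : Real.tan (c * m') < Real.tan (c * m) :=
    Real.tan_lt_tan_of_nonneg_of_lt_pi_div_two (by positivity) hcm (by gcongr)
  have htan0 : 0 < Real.tan (c * m) := Real.tan_pos_of_pos_of_lt_pi_div_two hcm0 hcm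
  have h1 : m' * Real.tan (c * m') < m' * Real.tan (c * m) := by gcongr
  have h2 : m' * Real.tan (c * m) < m * Real.tan (c * m) := by gcongr
  linarith

theorem isLeast_robinMu {β c : ℝ} (hβ : 0 < β) (hc : 0 < c) :
    IsLeast (muEquationSolutions β c) (robinMu β c) ∧ c * robinMu β c < Real.pi / 2 := by
  obtain ⟨m, hm, hlt⟩ := exists_isLeast_muEquationSolutions hβ hc
  have : robinMu β c = m := by rw [robinMu, if_neg hβ.ne', hm.csInf_eq]
  rw [this]
  exact ⟨hm, hlt⟩

theorem robinMu_pos {β c : ℝ} (hβ : 0 ≤ β) (hc : 0 < c) : 0 < robinMu β c := by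
  rcases hβ.eq_or_lt with rfl | hβ
  · rw [robinMu, if_pos rfl]
    have := Real.pi_pos
    positivity
  · exact (isLeast_robinMu hβ hc).1.1.1

theorem robinMu_mul_le {β c : ℝ} (hβ : 0 ≤ β) (hc : 0 < c) :
    robinMu β c * c ≤ Real.pi / 2 := by
  rcases hβ.eq_or_lt with rfl | hβ
  · rw [robinMu, if_pos rfl]
    exact le_of_eq (by field_simp)
  · rw [mul_comm]
    exact (isLeast_robinMu hβ hc).2.le

theorem cos_robinMu_mul {β c : ℝ} (hβ : 0 ≤ β) (hc : 0 < c) :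
    Real.cos (robinMu β c * c) = β * (robinMu β c * Real.sin (robinMu β c * c)) := by
  rcases hβ.eq_or_lt with rfl | hβ
  · have : robinMu 0 c * c = Real.pi / 2 := by
      rw [robinMu, if_pos rfl]; field_simp
    simp [this]
  · obtain ⟨⟨⟨hm0, hm⟩, -⟩, hlt⟩ := isLeast_robinMu hβ hc
    have hcos : 0 < Real.cos (c * robinMu β c) :=
      Real.cos_pos_of_mem_Ioo ⟨by have := mul_pos hc hm0; have := Real.pi_pos; linarith, hlt⟩
    rw [Real.tan_eq_sin_div_cos, ← mul_div_assoc, div_eq_div_iff hcos.ne' hβ.ne'] at hm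
    rw [mul_comm _ c]
    linarith

/-- Lowering the frequency makes the one-dimensional Robin boundary expression strictly positive. -/
theorem robin_cos_smul_pos {β c s : ℝ} (hβ : 0 ≤ β) (hc : 0 < c) (hs0 : 0 < s) (hs1 : s < 1) :
    0 < Real.cos (s * robinMu β c * c) -
      β * (s * robinMu β c * Real.sin (s * robinMu β c * c)) := by
  have hpi := Real.pi_pos
  have hm := robinMu_pos hβ hc
  have hle := robinMu_mul_le hβ hc
  have hmc : 0 < robinMu β c * c := mul_pos hm hc
  have hlt : s * robinMu β c * c < robinMu β c * c := by
    rw [mul_assoc]; exact mul_lt_of_lt_one_left hmc hs1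
  have hpos : 0 < s * robinMu β c * c := by positivity
  have h1 : Real.cos (robinMu β c * c) < Real.cos (s * robinMu β c * c) :=
    Real.cos_lt_cos_of_nonneg_of_le_pi_div_two hpos.le hle hlt
  have h2 : Real.sin (s * robinMu β c * c) ≤ Real.sin (robinMu β c * c) :=
    Real.sin_le_sin_of_le_of_le_pi_div_two (by linarith) hle hlt.le
  have h3 : 0 ≤ Real.sin (s * robinMu β c * c) :=
    Real.sin_nonneg_of_nonneg_of_le_pi hpos.le (by linarith)
  have h4 : s * robinMu β c ≤ robinMu β c := mul_le_of_le_one_left hm.le hs1.le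
  have h5 : β * (s * robinMu β c * Real.sin (s * robinMu β c * c)) ≤
      β * (robinMu β c * Real.sin (robinMu β c * c)) := by gcongr
  rw [cos_robinMu_mul hβ hc] at h1
  linarith

/-! ### The fundamental eigenvalue -/

theorem isRobinEigenfunction_cosProd {N : ℕ} {β : ℝ} (hβ : 0 ≤ β) {a : Fin N → ℝ}
    (ha : ∀ j, 0 < a j) :
    IsRobinEigenfunction β a (∑ j, robinMu β (a j) ^ 2)
      (cosProd fun j => robinMu β (a j)) where
  contDiffOn_open := (contDiff_cosProd _).contDiffOn
  contDiffOn_closed := (contDiff_cosProd _).contDiffOn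
  helmholtz x _ := by rw [laplacian_cosProd]; ring
  robin x hx j σ hσ hxj := by
    rw [((contDiff_cosProd _).differentiable one_ne_zero x).fderivWithin
      (uniqueDiffOn_closedBox ha x hx), robin_cosProd β a _ x j σ hσ hxj,
      cos_robinMu_mul hβ (ha j), sub_self, zero_mul]
  nontrivial := ⟨0, fun j => by simpa using ha j, by simp [cosProd]⟩

theorem IsRobinEigenfunction.neg {N : ℕ} {β : ℝ} {a : Fin N → ℝ} (ha : ∀ j, 0 < a j) {lam : ℝ}
    {u : EuclideanSpace ℝ (Fin N) → ℝ} (h : IsRobinEigenfunction β a lam u) :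
    IsRobinEigenfunction β a lam (-u) where
  contDiffOn_open := h.contDiffOn_open.neg
  contDiffOn_closed := h.contDiffOn_closed.neg
  helmholtz x hx := by
    rw [InnerProductSpace.laplacian_neg, Pi.neg_apply, Pi.neg_apply]
    linarith [h.helmholtz x hx]
  robin x hx j σ hσ hxj := by
    rw [fderivWithin_neg (uniqueDiffOn_closedBox ha x hx), neg_apply, Pi.neg_apply]
    linarith [h.robin x hx j σ hσ hxj]
  nontrivial := by simpa using h.nontrivial

/-- Comparison principle: a positive strict supersolution `φ` of the Robin problem excludes
eigenfunctions with a positive value. The function `u - M φ`, with `M = max u / φ`, is nonpositive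
and vanishes at the point where the maximum is attained; the boundary condition keeps this point
off the boundary, and the equation excludes it from the interior. -/
theorem IsRobinEigenfunction.nonpos_of_supersolution {N : ℕ} {β : ℝ} (hβ : 0 ≤ β)
    {a : Fin N → ℝ} (ha : ∀ j, 0 < a j) {lam : ℝ} {u φ : EuclideanSpace ℝ (Fin N) → ℝ}
    (h : IsRobinEigenfunction β a lam u) (hφ : ContDiff ℝ 2 φ) (hφ_pos : ∀ x ∈ closedBox a, 0 < φ x)
    (hφ_super : ∀ x ∈ openBox a, Laplacian.laplacian φ x + lam * φ x < 0)
    (hφ_robin : ∀ x ∈ closedBox a, ∀ (j : Fin N) (σ : ℝ), (σ = 1 ∨ σ = -1) → x j = σ * a j →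
      0 < β * fderiv ℝ φ x (EuclideanSpace.single j σ) + φ x)
    {x : EuclideanSpace ℝ (Fin N)} (hx : x ∈ closedBox a) : u x ≤ 0 := by
  by_contra! hux
  obtain ⟨y, hy, hmax⟩ := (isCompact_closedBox a).exists_isMaxOn ⟨x, hx⟩
    (h.contDiffOn_closed.continuousOn.div hφ.continuous.continuousOn
      fun z hz => (hφ_pos z hz).ne')
  set M := u y / φ y with hM
  have hMpos : 0 < M := (div_pos hux (hφ_pos x hx)).trans_le (hmax hx)
  have huy : u y = M * φ y := by rw [hM, div_mul_cancel₀ _ (hφ_pos y hy).ne']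
  have hle : IsMaxOn (u - M • φ) (closedBox a) y := by
    intro z hz
    have h1 : u z ≤ M * φ z := (div_le_iff₀ (hφ_pos z hz)).1 (hmax hz)
    simp only [Set.mem_ofPred_eq, Pi.sub_apply, Pi.smul_apply, smul_eq_mul, huy, sub_self]
    linarith
  by_cases hyo : y ∈ openBox a
  · have hnhds : openBox a ∈ nhds y := (isOpen_openBox a).mem_nhds hyo
    have hu : ContDiffAt ℝ 2 u y := h.contDiffOn_open.contDiffAt hnhds
    have hMφ : ContDiffAt ℝ 2 (M • φ) y := contDiffAt_const.smul hφ.contDiffAt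
    have hlap := (hle.isLocalMax
      (Filter.mem_of_superset hnhds (openBox_subset_closedBox a))).laplacian_nonpos (hu.sub hMφ)
    rw [hu.laplacian_sub hMφ, InnerProductSpace.laplacian_smul M hφ.contDiffAt, smul_eq_mul] at hlap
    have h1 := h.helmholtz y hyo
    have h2 := mul_neg_of_pos_of_neg hMpos (hφ_super y hyo)
    rw [huy] at h1
    linarith
  · obtain ⟨j, hj⟩ : ∃ j, a j ≤ |y j| := by simpa [openBox] using hyo
    have hj : |y j| = a j := le_antisymm (hy j) hj
    obtain ⟨σ, hσ, hyj⟩ : ∃ σ : ℝ, (σ = 1 ∨ σ = -1) ∧ y j = σ * a j := by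
      rcases abs_choice (y j) with h1 | h1
      · exact ⟨1, Or.inl rfl, by linarith⟩
      · exact ⟨-1, Or.inr rfl, by linarith⟩
    have hu := (h.contDiffOn_closed.differentiableOn one_ne_zero y hy).hasFDerivWithinAt
    have hφd := ((hφ.differentiable two_ne_zero y).hasFDerivAt.const_smul M).hasFDerivWithinAt
      (s := closedBox a)
    -- the maximum over the box is attained at `y`, hence the outward derivative is nonnegative
    have hd := hle.localize.hasFDerivWithinAt_nonpos (hu.sub hφd)
      (neg_single_mem_posTangentConeAt_closedBox ha hy hyj)
    rw [map_neg, map_smul, smul_eq_mul, neg_nonpos] at hd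
    have hd := nonneg_of_mul_nonneg_right hd (ha j)
    simp only [sub_apply, smul_apply, smul_eq_mul] at hd
    have h1 := h.robin y hy j σ hσ hyj
    have h2 := mul_pos hMpos (hφ_robin y hy j σ hσ hyj)
    have h3 := mul_nonneg hβ hd
    rw [huy] at h1
    linarith

theorem sum_robinMu_sq_le {N : ℕ} {β : ℝ} (hβ : 0 ≤ β) {a : Fin N → ℝ}
    (ha : ∀ j, 0 < a j) {lam : ℝ} (hlam : lam ∈ robinEigenvalues β a) :
    ∑ j, robinMu β (a j) ^ 2 ≤ lam := by
  obtain ⟨u, hu⟩ := hlam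
  by_contra! hlt
  -- lowering all frequencies by a factor `s < 1` close to `1` gives a strict supersolution
  obtain ⟨s, hslt, hs0, hs1⟩ : ∃ s : ℝ,
      lam < s ^ 2 * ∑ j, robinMu β (a j) ^ 2 ∧ 0 < s ∧ s < 1 := by
    have hcont : ContinuousAt (fun s : ℝ => s ^ 2 * ∑ j, robinMu β (a j) ^ 2) 1 := by fun_prop
    have h1 : ∀ᶠ s in nhdsWithin (1 : ℝ) (Set.Iio 1),
        lam < s ^ 2 * ∑ j, robinMu β (a j) ^ 2 :=
      nhdsWithin_le_nhds (hcont.eventually (lt_mem_nhds (by simpa using hlt)))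
    exact (h1.and (Ioo_mem_nhdsLT (zero_lt_one' ℝ))).exists
  have hcos : ∀ x ∈ closedBox a, ∀ j, 0 < Real.cos (s * robinMu β (a j) * x j) := by
    intro x hx j
    have hm := robinMu_pos hβ (ha j)
    have habs : |s * robinMu β (a j) * x j| < Real.pi / 2 := by
      rw [abs_mul, abs_of_pos (mul_pos hs0 hm)]
      calc s * robinMu β (a j) * |x j| ≤ s * robinMu β (a j) * a j := by gcongr; exact hx j
        _ = s * (robinMu β (a j) * a j) := by ring
        _ < robinMu β (a j) * a j := mul_lt_of_lt_one_left (mul_pos hm (ha j)) hs1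
        _ ≤ Real.pi / 2 := robinMu_mul_le hβ (ha j)
    exact Real.cos_pos_of_mem_Ioo (abs_lt.1 habs)
  have hpos : ∀ x ∈ closedBox a, 0 < cosProd (fun j => s * robinMu β (a j)) x :=
    fun x hx => Finset.prod_pos fun j _ => hcos x hx j
  have key : ∀ v, IsRobinEigenfunction β a lam v → ∀ x ∈ closedBox a, v x ≤ 0 := by
    intro v hv x hx
    refine hv.nonpos_of_supersolution hβ ha (contDiff_cosProd fun j => s * robinMu β (a j)) hpos
      (fun y hy => ?_) (fun y hy j σ hσ hyj => ?_) hx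
    · have := hpos y (openBox_subset_closedBox a hy)
      rw [laplacian_cosProd]
      simp only [mul_pow, ← Finset.mul_sum]
      linarith [mul_pos (sub_pos.2 hslt) this]
    · rw [robin_cosProd β a _ y j σ hσ hyj]
      exact mul_pos (robin_cos_smul_pos hβ (ha j) hs0 hs1)
        (Finset.prod_pos fun i _ => hcos y hy i)
  obtain ⟨x, hx, hne⟩ := hu.nontrivial
  have hx' := openBox_subset_closedBox a hx
  have h1 := key u hu x hx'
  have h2 := key (-u) (hu.neg ha) x hx'
  rw [Pi.neg_apply] at h2
  exact hne (by linarith)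

theorem isLeast_robinEigenvalues {N : ℕ} {β : ℝ} (hβ : 0 ≤ β) {a : Fin N → ℝ}
    (ha : ∀ j, 0 < a j) :
    IsLeast (robinEigenvalues β a) (∑ j, robinMu β (a j) ^ 2) :=
  ⟨⟨_, isRobinEigenfunction_cosProd hβ ha⟩, fun _ h => sum_robinMu_sq_le hβ ha h⟩

theorem fundamentalRobinEigenvalue_eq {N : ℕ} {β : ℝ} (hβ : 0 ≤ β) {a : Fin N → ℝ}
    (ha : ∀ j, 0 < a j) :
    fundamentalRobinEigenvalue β a = ∑ j, robinMu β (a j) ^ 2 :=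
  (isLeast_robinEigenvalues hβ ha).csInf_eq

/-! ### Convexity of `μ²` in the logarithm of the half-side -/

/-- `tan θ / θ` is increasing on `(0, π / 2)`. -/
theorem monotoneOn_tan_div_self :
    MonotoneOn (fun θ => Real.tan θ / θ) (Set.Ioo 0 (Real.pi / 2)) := by
  have hd : ∀ θ ∈ Set.Ioo 0 (Real.pi / 2), HasDerivAt (fun θ => Real.tan θ / θ)
      ((1 / Real.cos θ ^ 2 * θ - Real.tan θ * 1) / θ ^ 2) θ := fun θ hθ =>
    (Real.hasDerivAt_tan (Real.cos_pos_of_mem_Ioo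
      ⟨by linarith [hθ.1, Real.pi_pos], hθ.2⟩).ne').div (hasDerivAt_id θ) hθ.1.ne'
  refine monotoneOn_of_deriv_nonneg (convex_Ioo _ _)
    (fun θ hθ => (hd θ hθ).continuousAt.continuousWithinAt)
    (fun θ hθ => (hd θ (interior_subset hθ)).differentiableAt.differentiableWithinAt)
    fun θ hθ => ?_
  have hθ := interior_subset hθ
  rw [(hd θ hθ).deriv]
  have hcos : 0 < Real.cos θ :=
    Real.cos_pos_of_mem_Ioo ⟨by linarith [hθ.1, Real.pi_pos], hθ.2⟩
  have hsc : Real.sin θ * Real.cos θ ≤ θ :=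
    (mul_le_of_le_one_right (Real.sin_nonneg_of_nonneg_of_le_pi hθ.1.le
      (by linarith [hθ.2, Real.pi_pos])) (Real.cos_le_one θ)).trans (Real.sin_le hθ.1.le)
  have heq : 1 / Real.cos θ ^ 2 * θ - Real.tan θ * 1 =
      (θ - Real.sin θ * Real.cos θ) / Real.cos θ ^ 2 := by
    rw [Real.tan_eq_sin_div_cos]; field_simp
  rw [heq]
  have := sub_nonneg.2 hsc
  positivity

/-- The slope function of the curve `θ ↦ (log (θ tan θ), cot² θ)`: the slope at `θ` is
`-2 / cotSqSlope θ`. -/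
noncomputable def cotSqSlope (θ : ℝ) : ℝ :=
  Real.tan θ ^ 2 + Real.tan θ / θ * Real.sin θ ^ 2

theorem cotSqSlope_pos {θ : ℝ} (hθ : θ ∈ Set.Ioo 0 (Real.pi / 2)) : 0 < cotSqSlope θ := by
  have := Real.tan_pos_of_pos_of_lt_pi_div_two hθ.1 hθ.2
  have := hθ.1
  unfold cotSqSlope
  positivity

theorem monotoneOn_cotSqSlope : MonotoneOn cotSqSlope (Set.Ioo 0 (Real.pi / 2)) := by
  intro x hx y hy hxy
  have hx0 := hx.1
  have htan : Real.tan x ≤ Real.tan y :=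
    Real.strictMonoOn_tan.monotoneOn ⟨by linarith [Real.pi_pos], hx.2⟩
      ⟨by linarith [hy.1, Real.pi_pos], hy.2⟩ hxy
  have htx := Real.tan_pos_of_pos_of_lt_pi_div_two hx.1 hx.2
  have hty := Real.tan_pos_of_pos_of_lt_pi_div_two hy.1 hy.2
  have hsin : Real.sin x ≤ Real.sin y :=
    Real.sin_le_sin_of_le_of_le_pi_div_two (by linarith [Real.pi_pos]) hy.2.le hxy
  have hsx : 0 ≤ Real.sin x :=
    Real.sin_nonneg_of_nonneg_of_le_pi hx.1.le (by linarith [hx.2, Real.pi_pos])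
  have hdiv : Real.tan x / x ≤ Real.tan y / y := monotoneOn_tan_div_self hx hy hxy
  have := div_pos hty hy.1
  unfold cotSqSlope
  gcongr

/-- Supporting line of the curve `θ ↦ (log θ + log (tan θ), cot² θ)` at `θ₀`. -/
theorem cot_sq_supporting_line {θ₀ θ : ℝ} (hθ₀ : θ₀ ∈ Set.Ioo 0 (Real.pi / 2))
    (hθ : θ ∈ Set.Ioo 0 (Real.pi / 2)) :
    ((Real.tan θ₀)⁻¹) ^ 2 + -(2 / cotSqSlope θ₀) *
      ((Real.log θ + Real.log (Real.tan θ)) - (Real.log θ₀ + Real.log (Real.tan θ₀))) ≤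
    ((Real.tan θ)⁻¹) ^ 2 := by
  set k := 2 / cotSqSlope θ₀ with hk
  -- up to a constant, `K` is the height of the curve above the line; its derivative at `x` has
  -- the sign of `x - θ₀`
  set K : ℝ → ℝ := fun x => ((Real.tan x)⁻¹) ^ 2 + k * (Real.log x + Real.log (Real.tan x)) with hK
  have hd : ∀ x ∈ Set.Ioo 0 (Real.pi / 2), HasDerivAt K
      ((1 / x + 1 / (Real.sin x * Real.cos x)) * (k - 2 / cotSqSlope x)) x := by
    intro x hx
    have hx0 := hx.1
    have hc : 0 < Real.cos x :=
      Real.cos_pos_of_mem_Ioo ⟨by linarith [hx.1, Real.pi_pos], hx.2⟩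
    have hs : 0 < Real.sin x :=
      Real.sin_pos_of_pos_of_lt_pi hx.1 (by linarith [hx.2, Real.pi_pos])
    have ht := Real.tan_pos_of_pos_of_lt_pi_div_two hx.1 hx.2
    have hT := Real.hasDerivAt_tan hc.ne'
    have h := ((hT.inv ht.ne').pow 2).add
      (((Real.hasDerivAt_log hx0.ne').add (hT.log ht.ne')).const_mul k)
    refine HasDerivAt.congr_deriv h ?_
    simp only [cotSqSlope, Real.tan_eq_sin_div_cos, Pi.inv_apply, Nat.add_one_sub_one, pow_one,
      inv_div, Nat.cast_ofNat]
    field_simp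
    ring
  have hfac : ∀ x ∈ Set.Ioo 0 (Real.pi / 2), 0 ≤ 1 / x + 1 / (Real.sin x * Real.cos x) := by
    intro x hx
    have hx0 := hx.1
    have hc : 0 < Real.cos x :=
      Real.cos_pos_of_mem_Ioo ⟨by linarith [hx.1, Real.pi_pos], hx.2⟩
    have hs : 0 < Real.sin x :=
      Real.sin_pos_of_pos_of_lt_pi hx.1 (by linarith [hx.2, Real.pi_pos])
    positivity
  have hKle : K θ₀ ≤ K θ := by
    rcases le_total θ₀ θ with hle | hle
    · have hsub : Set.Icc θ₀ θ ⊆ Set.Ioo 0 (Real.pi / 2) :=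
        Set.Icc_subset_Ioo hθ₀.1 hθ.2
      refine monotoneOn_of_deriv_nonneg (convex_Icc θ₀ θ)
        (fun x hx => (hd x (hsub hx)).continuousAt.continuousWithinAt)
        (fun x hx =>
          (hd x (hsub (interior_subset hx))).differentiableAt.differentiableWithinAt)
        (fun x hx => ?_) (Set.left_mem_Icc.2 hle) (Set.right_mem_Icc.2 hle) hle
      have hx := interior_subset hx
      rw [(hd x (hsub hx)).deriv]
      refine mul_nonneg (hfac x (hsub hx)) (sub_nonneg.2 ?_)
      exact div_le_div_of_nonneg_left zero_le_two (cotSqSlope_pos hθ₀)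
        (monotoneOn_cotSqSlope hθ₀ (hsub hx) hx.1)
    · have hsub : Set.Icc θ θ₀ ⊆ Set.Ioo 0 (Real.pi / 2) :=
        Set.Icc_subset_Ioo hθ.1 hθ₀.2
      refine antitoneOn_of_deriv_nonpos (convex_Icc θ θ₀)
        (fun x hx => (hd x (hsub hx)).continuousAt.continuousWithinAt)
        (fun x hx =>
          (hd x (hsub (interior_subset hx))).differentiableAt.differentiableWithinAt)
        (fun x hx => ?_) (Set.left_mem_Icc.2 hle) (Set.right_mem_Icc.2 hle) hle
      have hx := interior_subset hx
      rw [(hd x (hsub hx)).deriv]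
      refine mul_nonpos_of_nonneg_of_nonpos (hfac x (hsub hx)) (sub_nonpos.2 ?_)
      exact div_le_div_of_nonneg_left zero_le_two (cotSqSlope_pos (hsub hx))
        (monotoneOn_cotSqSlope (hsub hx) hθ₀ hx.2)
  simp only [hK] at hKle
  linarith

theorem convexOn_univ_of_supporting_line {f m : ℝ → ℝ}
    (h : ∀ x y, f x + m x * (y - x) ≤ f y) : ConvexOn ℝ Set.univ f := by
  refine ⟨convex_univ, fun x _ y _ s t hs ht hst => ?_⟩
  have h1 := mul_le_mul_of_nonneg_left (h (s * x + t * y) x) hs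
  have h2 := mul_le_mul_of_nonneg_left (h (s * x + t * y) y) ht
  simp only [smul_eq_mul]
  have hs' : s = 1 - t := by linarith
  subst hs'
  linarith

theorem convexOn_robinMu_exp_sq {β : ℝ} (hβ : 0 ≤ β) :
    ConvexOn ℝ Set.univ fun ℓ : ℝ => robinMu β (Real.exp ℓ) ^ 2 := by
  rcases hβ.eq_or_lt with rfl | hβ
  · have h : (fun ℓ : ℝ => robinMu 0 (Real.exp ℓ) ^ 2) =
        fun ℓ : ℝ => (Real.pi / 2) ^ 2 * Real.exp (-2 * ℓ) := by
      funext ℓ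
      rw [robinMu, if_pos rfl, neg_mul, Real.exp_neg, show 2 * ℓ = ℓ + ℓ by ring,
        Real.exp_add]
      field_simp
    rw [h]
    exact (convexOn_exp.comp_linearMap (LinearMap.mul ℝ ℝ (-2))).smul (by positivity)
  · -- in terms of `θ = c μ(β, c)` with `c = exp ℓ`, one has `ℓ = log β + log θ + log (tan θ)` and
    -- `μ² = cot² θ / β²`
    set θ : ℝ → ℝ := fun ℓ => Real.exp ℓ * robinMu β (Real.exp ℓ) with hθdef
    have hθ : ∀ ℓ, θ ℓ ∈ Set.Ioo 0 (Real.pi / 2) := fun ℓ =>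
      ⟨mul_pos (Real.exp_pos ℓ) (robinMu_pos hβ.le (Real.exp_pos ℓ)),
        (isLeast_robinMu hβ (Real.exp_pos ℓ)).2⟩
    have htan : ∀ ℓ, 0 < Real.tan (θ ℓ) := fun ℓ =>
      Real.tan_pos_of_pos_of_lt_pi_div_two (hθ ℓ).1 (hθ ℓ).2
    have hmu : ∀ ℓ, robinMu β (Real.exp ℓ) = β⁻¹ * (Real.tan (θ ℓ))⁻¹ := fun ℓ => by
      have h := (isLeast_robinMu hβ (Real.exp_pos ℓ)).1.1.2
      rw [eq_mul_inv_iff_mul_eq₀ (htan ℓ).ne', h, one_div]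
    have hlog : ∀ ℓ, ℓ = Real.log β + (Real.log (θ ℓ) + Real.log (Real.tan (θ ℓ))) := fun ℓ => by
      have h : Real.exp ℓ = β * (θ ℓ * Real.tan (θ ℓ)) := by
        have h := (isLeast_robinMu hβ (Real.exp_pos ℓ)).1.1.2
        calc Real.exp ℓ = Real.exp ℓ * (β * (1 / β)) := by field_simp
          _ = β * (θ ℓ * Real.tan (θ ℓ)) := by rw [← h]; simp only [hθdef]; ring
      rw [← Real.log_mul (hθ ℓ).1.ne' (htan ℓ).ne', ← Real.log_mul hβ.ne'
        (mul_pos (hθ ℓ).1 (htan ℓ)).ne', ← h, Real.log_exp]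
    refine convexOn_univ_of_supporting_line
      (m := fun ℓ => (β⁻¹) ^ 2 * -(2 / cotSqSlope (θ ℓ))) fun x y => ?_
    have h := mul_le_mul_of_nonneg_left (cot_sq_supporting_line (hθ x) (hθ y))
      (sq_nonneg β⁻¹)
    have hxy : y - x = (Real.log (θ y) + Real.log (Real.tan (θ y))) -
        (Real.log (θ x) + Real.log (Real.tan (θ x))) := by
      linarith [hlog x, hlog y]
    rw [hmu x, hmu y, mul_pow, mul_pow, hxy]
    linarith

theorem convexOn_fundamentalRobinEigenvalue_exp {N : ℕ} {β : ℝ} (hβ : 0 ≤ β) :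
    ConvexOn ℝ Set.univ
      fun ℓ : Fin N → ℝ => fundamentalRobinEigenvalue β fun j => Real.exp (ℓ j) := by
  simp only [fundamentalRobinEigenvalue_eq hβ fun _ => Real.exp_pos _]
  refine ⟨convex_univ, fun x _ y _ s t hs ht hst => ?_⟩
  simp only [smul_eq_mul, Finset.mul_sum, ← Finset.sum_add_distrib]
  exact Finset.sum_le_sum fun j _ =>
    (convexOn_robinMu_exp_sq hβ).2 (Set.mem_univ (x j)) (Set.mem_univ (y j)) hs ht hst

theorem mainTheorem4 (N : ℕ) (hN : 1 ≤ N) (β : ℝ) (hβ : 0 ≤ β) :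
    -- `μ` is well defined
    (0 < β → ∀ c : ℝ, 0 < c →
      IsLeast (muEquationSolutions β c) (robinMu β c) ∧ robinMu β c < Real.pi / (2 * c)) ∧
    -- the fundamental eigenvalue exists and is given by the explicit formula
    (∀ a : Fin N → ℝ, (∀ j, 0 < a j) →
      IsLeast (robinEigenvalues β a) (fundamentalRobinEigenvalue β a) ∧
      fundamentalRobinEigenvalue β a = ∑ j, robinMu β (a j) ^ 2) ∧
    -- it is a convex function of the logarithms of the half-sides
    ConvexOn ℝ Set.univ
      (fun ℓ : Fin N → ℝ => fundamentalRobinEigenvalue β (fun j => Real.exp (ℓ j))) ∧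
    -- it is convex along geometric interpolations
    (∀ a₀ a₁ : Fin N → ℝ, (∀ j, 0 < a₀ j) → (∀ j, 0 < a₁ j) → ∀ t : ℝ, 0 < t → t < 1 →
      fundamentalRobinEigenvalue β (fun j => a₀ j ^ (1 - t) * a₁ j ^ t) ≤
        (1 - t) * fundamentalRobinEigenvalue β a₀ + t * fundamentalRobinEigenvalue β a₁) := by
  refine ⟨fun hβ c hc => ?_, fun a ha => ?_, convexOn_fundamentalRobinEigenvalue_exp hβ,
    fun a₀ a₁ h₀ h₁ t ht0 ht1 => ?_⟩
  · obtain ⟨h, hlt⟩ := isLeast_robinMu hβ hc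
    refine ⟨h, (lt_div_iff₀ (by positivity)).2 ?_⟩
    linarith
  · rw [fundamentalRobinEigenvalue_eq hβ ha]
    exact ⟨isLeast_robinEigenvalues hβ ha, rfl⟩
  · have h := (convexOn_fundamentalRobinEigenvalue_exp (N := N) hβ).2
      (Set.mem_univ fun j => Real.log (a₀ j)) (Set.mem_univ fun j => Real.log (a₁ j))
      (sub_nonneg.2 ht1.le) ht0.le (sub_add_cancel 1 t)
    have hpow : ∀ j, Real.exp ((1 - t) * Real.log (a₀ j) + t * Real.log (a₁ j)) =
        a₀ j ^ (1 - t) * a₁ j ^ t := fun j => by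
      rw [Real.exp_add, Real.rpow_def_of_pos (h₀ j), Real.rpow_def_of_pos (h₁ j), mul_comm (1 - t),
        mul_comm t]
    simpa only [Pi.add_apply, Pi.smul_apply, smul_eq_mul, hpow, Real.exp_log (h₀ _),
      Real.exp_log (h₁ _)] using h
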